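/- Let $n\ge 0$ be an integer and let $V(z,\bar z)$ be a function on $\mathbb C$ with values in $\mathbb C\cup\{-\infty\}$ (with $e^{-\infty}=0$) such that for all integers $k,m\ge 0$ the function $z^k\bar z^m e^{V(z,\bar z)}$ is Lebesgue integrable on $\mathbb C$. Define the bimoments $$g_{km}=\int_{\mathbb C} z^k\bar z^m e^{V(z,\bar z)}\,d^2z ,\qquad k,m\ge 0 .$$ Let ${\bf t}=(t_1,t_2,\dots)$ and ${\bf t}'=(t'_1,t'_2,\dots)$ be formal variables (the coupling constants), and let the partition function of the model of normal matrices, $$Z_n(V;{\bf t},{\bf t}')=\int_{\mathbb C^n}|\Delta(z)|^2\prod_{i=1}^n \exp\Bigl(\sum_{m\ge1}t_m z_i^m+\sum_{m\ge1}t'_m\bar z_i^m\Bigr)e^{V(z_i,\bar z_i)}\,d^2z_i,\qquad \Delta(z)=\det\bigl(z_i^{n-k}\bigr)_{i,k=1,\dots,n},$$ be understood as its perturbation series: the integrand is expanded as a formal power series in ${\bf t},{\bf t}'$ and integrated coefficient by coefficient. For a partition $\lambda=(\lambda_1\ge\lambda_2\ge\cdots)$ with number of nonzero parts $\ell(\lambda)$,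 let $$s_\lambda({\bf t})=\det\bigl(h_{\lambda_i-i+j}({\bf t})\bigr)_{1\le i,j\le \ell(\lambda)},\qquad \sum_{k\ge0}x^kh_k({\bf t})=\exp\sum_{m\ge1}x^mt_m,\qquad h_k=0\ \text{ for } k<0 .$$ Then all the integrals of coefficients converge absolutely, and, as formal power series in ${\bf t},{\bf t}'$, $$Z_n(V;{\bf t},{\bf t}')=n!\sum_{\ell(\lambda),\,\ell(\lambda')\le n} g_{\lambda,\lambda'}(n)\,s_\lambda({\bf t})\,s_{\lambda'}({\bf t}'),\qquad g_{\lambda,\lambda'}(n)=\det\bigl(g_{h_ih'_j}\bigr)_{i,j=1,\dots,n},$$ where the sum is over pairs of partitions, $h_i=\lambda_i-i+n$ and $h'_i=\lambda'_i-i+n$; each monomial in ${\bf t},{\bf t}'$ occurs in only finitely many terms of the sum. -/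

import Mathlib

open MeasureTheory
open scoped ComplexConjugate Nat

namespace NormalMatrixModel

noncomputable section

/-- Partitions: non-increasing sequences `(λ₁, λ₂, …)` of non-negative integers with
`λ_r = 0` for large `r`. The part `λ_{i+1}` is `l.1 i`. -/
def Ptn : Type := {l : ℕ →₀ ℕ // Antitone l}

/-- The length of a partition: the number of its nonzero parts. -/
def Ptn.length (l : Ptn) : ℕ := l.1.support.card

/-- The shifted part `h_i = λ_i - i + n`, for `1 ≤ i ≤ n`. The index `i` starts at `0` here, and the
subtraction is never truncated, because `i + 1 ≤ n`. -/
def Ptn.shifted {n : ℕ} (l : Ptn) (i : Fin n) : ℕ := l.1 i + n - (i + 1)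

/-- The elementary Schur functions `h_k(t)`, given by `∑_k x^k h_k(t) = exp (∑_{m ≥ 1} x^m t_m)` in
the ring of power series in `x` over `A`, with `h_k = 0` for `k < 0`. -/
def elemSchur {A : Type*} [CommRing A] [Algebra ℚ A] (t : ℕ+ → A) (k : ℤ) : A :=
  if k < 0 then 0
  else PowerSeries.coeff k.toNat ((PowerSeries.exp A).subst
    (PowerSeries.mk fun m : ℕ => if hm : 0 < m then t ⟨m, hm⟩ else 0))

/-- The Schur function `s_λ(t) = det (h_{λ_i - i + j}(t))_{1 ≤ i, j ≤ ℓ(λ)}`. -/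
def schur {A : Type*} [CommRing A] [Algebra ℚ A] (t : ℕ+ → A) (l : Ptn) : A :=
  Matrix.det (Matrix.of fun i j : Fin l.length =>
    elemSchur t ((l.1 i : ℤ) - (i : ℤ) + (j : ℤ)))

/-- Formal power series over `ℂ` in the couplings `t₁, t₂, …` and `t'₁, t'₂, …`. -/
abbrev Couplings : Type := MvPowerSeries (ℕ+ ⊕ ℕ+) ℂ

/-- The coupling constants `t = (t₁, t₂, …)`. -/
def t (m : ℕ+) : Couplings := MvPowerSeries.X (Sum.inl m)

/-- The coupling constants `t' = (t'₁, t'₂, …)`. -/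
def t' (m : ℕ+) : Couplings := MvPowerSeries.X (Sum.inr m)

/-- A family of formal power series is formally summable if every monomial occurs in only finitely
many members. -/
def FormallySummable {ι : Type*} (f : ι → Couplings) : Prop :=
  ∀ d, {i | MvPowerSeries.coeff d (f i) ≠ 0}.Finite

/-- The coefficientwise sum of a formally summable family. -/
def formalSum {ι : Type*} (f : ι → Couplings) : Couplings :=
  fun d => ∑ᶠ i, MvPowerSeries.coeff d (f i)

/-- `ξ(u, z) = ∑_{m ≥ 1} u_m z^m`, for a complex number `z`. -/
def xi (u : ℕ+ → Couplings) (z : ℂ) : Couplings :=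
  formalSum fun m : ℕ+ => MvPowerSeries.C (z ^ (m : ℕ)) * u m

/-- The exponential on `ℂ ∪ {-∞}`, with `exp (-∞) = 0`. -/
def expBot (v : WithBot ℂ) : ℂ := v.recBotCoe 0 Complex.exp

/-- The weight `e^{V(z, z̄)}`. -/
def weight (V : ℂ → ℂ → WithBot ℂ) (z : ℂ) : ℂ := expBot (V z (conj z))

/-- The bimoment `g_{km} = ∫ z^k z̄^m e^{V(z, z̄)} d²z`. -/
def bimoment (V : ℂ → ℂ → WithBot ℂ) (k m : ℕ) : ℂ :=
  ∫ z : ℂ, z ^ k * conj z ^ m * weight V z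

/-- `g_{λ,λ'}(n) = det (g_{h_i h'_j})_{1 ≤ i, j ≤ n}`. -/
def bimomentDet (V : ℂ → ℂ → WithBot ℂ) (n : ℕ) (l l' : Ptn) : ℂ :=
  Matrix.det (Matrix.of fun i j : Fin n => bimoment V (l.shifted i) (l'.shifted j))

/-- The Vandermonde determinant `Δ(z) = det (z_i^{n-k})_{1 ≤ i, k ≤ n}`. -/
def vandermondeDet {n : ℕ} (z : Fin n → ℂ) : ℂ :=
  Matrix.det (Matrix.of fun i k : Fin n => z i ^ (n - ((k : ℕ) + 1)))

/-- The integrand `|Δ(z)|² ∏_i e^{V₁(z_i) + V₂(z̄_i)} e^{V(z_i, z̄_i)}`, where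
`V₁(z) = ξ(t, z)` and `V₂(z̄) = ξ(t', z̄)`, expanded as a formal power series in the couplings. -/
def integrand (V : ℂ → ℂ → WithBot ℂ) {n : ℕ} (z : Fin n → ℂ) : Couplings :=
  MvPowerSeries.C ((‖vandermondeDet z‖ ^ 2 : ℝ) : ℂ) *
    ∏ i, ((PowerSeries.exp ℂ).subst (xi t (z i) + xi t' (conj (z i))) *
      MvPowerSeries.C (weight V (z i)))

/-- The perturbation series of the partition function `Z_n(V; t, t')`: the coefficient of every
monomial in the couplings is the integral over `ℂⁿ` of its coefficient in the integrand. -/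
def partitionFunction (V : ℂ → ℂ → WithBot ℂ) (n : ℕ) : Couplings :=
  fun d => ∫ z : Fin n → ℂ, MvPowerSeries.coeff d (integrand V z)

/-- The term `g_{λ,λ'}(n) s_λ(t) s_{λ'}(t')`, for partitions `λ`, `λ'` of length at most `n`. -/
def doubleSchurTerm (V : ℂ → ℂ → WithBot ℂ) (n : ℕ)
    (p : {l : Ptn // l.length ≤ n} × {l : Ptn // l.length ≤ n}) : Couplings :=
  MvPowerSeries.C (bimomentDet V n p.1.1 p.2.1) * schur t p.1.1 * schur t' p.2.1

end

end NormalMatrixModel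

namespace NormalMatrixModel

/-! Give `t_m` and `t'_m` weight `m`. Since `z^b e^{ξ(t,z)} = ∑_a z^a h_{a-b}(t)`, the product of
`Δ(z)` and the exponentials `e^{ξ(t,z_i)}` is the determinant of a product of two rectangular
matrices, `(z_i^a)` and `(h_{a-n+j}(t))`. Cauchy–Binet (`det_sum_mul_eq_sum_strictAnti`) writes it
as a sum over decreasing sequences `f` of `det (z_i^{f_j})` times a minor in `t`. Such sequences are
the shifted parts of partitions of length at most `n`, and the minor is then `s_λ(t)`
(`bijective_shifted`, `schur_eq_minor`).

The same holds for `z̄` and `t'`. As `|Δ(z)|² = Δ(z) Δ(z̄)`, the integrand is a double sum of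
products of two determinants and the weights, and Andréief's identity integrates each term to `n!
det (g_{f_i g_j})`.

Modulo monomials of weight at least `N` it suffices to take `a < N + n`. So each coefficient
involves finite sums only, and they commute with the integral. -/

/-! ### The Cauchy–Binet formula -/

theorem det_sum_mul {R κ : Type*} [CommRing R] {n : ℕ} [DecidableEq κ] (s : Finset κ)
    (P : Fin n → κ → R) (A : κ → Fin n → R) :
    Matrix.det (Matrix.of fun i j => ∑ a ∈ s, P i a * A a j) =
      ∑ f ∈ Fintype.piFinset fun _ : Fin n => s,
        (∏ i, P i (f i)) * Matrix.det (Matrix.of fun i j => A (f i) j) := by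
  simp_rw [← Matrix.det_transpose (Matrix.of _), Matrix.det_apply', Matrix.transpose_apply,
    Matrix.of_apply, Finset.prod_univ_sum, Finset.mul_sum]
  rw [Finset.sum_comm]
  refine Finset.sum_congr rfl fun f _ => Finset.sum_congr rfl fun σ _ => ?_
  rw [Finset.prod_mul_distrib]
  ring

/-- The Cauchy–Binet formula, with the minors indexed by decreasing sequences. -/
theorem det_sum_mul_eq_sum_strictAnti {R κ : Type*} [CommRing R] [LinearOrder κ] {n : ℕ}
    (s : Finset κ) (P : Fin n → κ → R) (A : κ → Fin n → R)
    [DecidablePred fun f : Fin n → κ => StrictAnti f] :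
    Matrix.det (Matrix.of fun i j => ∑ a ∈ s, P i a * A a j) =
      ∑ f ∈ (Fintype.piFinset fun _ : Fin n => s) with StrictAnti f,
        Matrix.det (Matrix.of fun i j => P i (f j)) *
          Matrix.det (Matrix.of fun i j => A (f i) j) := by
  classical
  have hperm (f : Fin n → κ) (σ : Equiv.Perm (Fin n)) :
      Matrix.det (Matrix.of fun i j => A (f (σ i)) j) =
        (Equiv.Perm.sign σ : ℤ) * Matrix.det (Matrix.of fun i j => A (f i) j) :=
    Matrix.det_permute σ (Matrix.of fun i j => A (f i) j)
  have hP (f : Fin n → κ) : Matrix.det (Matrix.of fun i j => P i (f j)) =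
      ∑ σ : Equiv.Perm (Fin n), (Equiv.Perm.sign σ : ℤ) * ∏ i, P i (f (σ i)) := by
    rw [← Matrix.det_transpose, Matrix.det_apply']
    rfl
  rw [det_sum_mul]
  -- A non-injective `f` gives two equal rows. An injective one is uniquely a decreasing sequence
  -- composed with a permutation, whose sign produces the second determinant.
  rw [← Finset.sum_filter_of_ne (p := fun f => Function.Injective f)]
  · simp_rw [hP, Finset.sum_mul]
    rw [← Finset.sum_product']
    symm
    refine Finset.sum_bij (fun p _ => p.1 ∘ p.2) ?_ ?_ ?_ ?_
    · rintro ⟨f, σ⟩ h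
      simp only [Finset.mem_product, Finset.mem_filter, Fintype.mem_piFinset, Finset.mem_univ,
        and_true] at h ⊢
      exact ⟨fun i => h.1 _, h.2.injective.comp σ.injective⟩
    · rintro ⟨f, σ⟩ h ⟨g, τ⟩ h' e
      simp only [Finset.mem_product, Finset.mem_filter, Finset.mem_univ, and_true] at h h' e
      have hr : Set.range f = Set.range g := by
        rw [← σ.surjective.range_comp f, ← τ.surjective.range_comp g, e]
      have hfg : f = g := by
        have h1 := (h.2.dual_right).range_inj (h'.2.dual_right)
        have h2 : (OrderDual.toDual ∘ f) = (OrderDual.toDual ∘ g) :=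
          h1.1 (by rw [Set.range_comp, Set.range_comp, hr])
        exact h2
      subst hfg
      congr 1
      ext i : 1
      exact h.2.injective (congrFun e i)
    · intro f hf
      simp only [Finset.mem_filter, Fintype.mem_piFinset] at hf
      -- Sorting gives the increasing order, so it is followed by a reversal.
      refine ⟨(f ∘ Tuple.sort f ∘ Fin.rev, (Fin.revPerm.trans (Tuple.sort f)).symm), ?_, ?_⟩
      · simp only [Finset.mem_product, Finset.mem_filter, Fintype.mem_piFinset, Finset.mem_univ,
          and_true]
        refine ⟨fun i => hf.1 _, ?_⟩
        have hm : StrictMono (f ∘ Tuple.sort f) :=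
          (Tuple.monotone_sort f).strictMono_of_injective (hf.2.comp (Tuple.sort f).injective)
        exact hm.comp_strictAnti Fin.rev_strictAnti
      · ext i
        simp
    · rintro ⟨f, σ⟩ _
      simp only [Function.comp_apply]
      rw [hperm]
      ring
  · intro f _ hne i j hij
    by_contra hne'
    exact hne (by rw [Matrix.det_zero_of_row_eq hne' (by ext k; simp [hij]), mul_zero])

/-! ### Andréief's identity -/

section Andreief

variable {n : ℕ} (p q : Fin n → ℂ → ℂ) (w : ℂ → ℂ)

/-- Expanding both determinants separates the variables, so that integrals over `ℂⁿ` become products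
of integrals over `ℂ`. -/
theorem det_mul_det_mul_prod_eq_sum (z : Fin n → ℂ) :
    Matrix.det (Matrix.of fun i j => p j (z i)) * Matrix.det (Matrix.of fun i j => q j (z i)) *
      ∏ i, w (z i) =
    ∑ σ : Equiv.Perm (Fin n), ∑ τ : Equiv.Perm (Fin n),
      ((Equiv.Perm.sign σ : ℤ) * (Equiv.Perm.sign τ : ℤ) : ℂ) *
        ∏ i, (p (σ i) (z i) * q (τ i) (z i) * w (z i)) := by
  rw [← Matrix.det_transpose, ← Matrix.det_transpose (Matrix.of fun i j => q j (z i)),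
    Matrix.det_apply', Matrix.det_apply', Finset.sum_mul_sum, Finset.sum_mul]
  refine Finset.sum_congr rfl fun σ _ => ?_
  rw [Finset.sum_mul]
  refine Finset.sum_congr rfl fun τ _ => ?_
  simp only [Matrix.transpose_apply, Matrix.of_apply, Finset.prod_mul_distrib]
  ring

variable {p q w}

theorem integrable_det_mul_det_mul_prod
    (h : ∀ i j, Integrable (fun z => p i z * q j z * w z) volume) :
    Integrable (fun z : Fin n → ℂ => Matrix.det (Matrix.of fun i j => p j (z i)) *
      Matrix.det (Matrix.of fun i j => q j (z i)) * ∏ i, w (z i)) volume := by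
  simp_rw [det_mul_det_mul_prod_eq_sum]
  refine integrable_finsetSum _ fun σ _ => integrable_finsetSum _ fun τ _ => ?_
  exact (Integrable.fintype_prod_dep (μ := fun _ => volume) fun i => h (σ i) (τ i)).const_mul _

/-- Andréief's identity. -/
theorem integral_det_mul_det_mul_prod
    (h : ∀ i j, Integrable (fun z => p i z * q j z * w z) volume) :
    ∫ z : Fin n → ℂ, Matrix.det (Matrix.of fun i j => p j (z i)) *
      Matrix.det (Matrix.of fun i j => q j (z i)) * ∏ i, w (z i) =
    (n ! : ℂ) * Matrix.det (Matrix.of fun i j => ∫ z, p i z * q j z * w z) := by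
  simp_rw [det_mul_det_mul_prod_eq_sum]
  have hint (σ τ : Equiv.Perm (Fin n)) : Integrable (fun z : Fin n → ℂ =>
      ((Equiv.Perm.sign σ : ℤ) * (Equiv.Perm.sign τ : ℤ) : ℂ) *
        ∏ i, (p (σ i) (z i) * q (τ i) (z i) * w (z i))) volume :=
    (Integrable.fintype_prod_dep (μ := fun _ => volume) fun i => h (σ i) (τ i)).const_mul _
  rw [integral_finsetSum _ fun σ _ => integrable_finsetSum _ fun τ _ => hint σ τ]
  -- Permuting the rows by `σ` costs the sign of `σ`, which cancels the sign already present. All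
  -- `n!` permutations contribute equally.
  have key (σ : Equiv.Perm (Fin n)) :
      ∫ z : Fin n → ℂ, ∑ τ : Equiv.Perm (Fin n),
        ((Equiv.Perm.sign σ : ℤ) * (Equiv.Perm.sign τ : ℤ) : ℂ) *
          ∏ i, (p (σ i) (z i) * q (τ i) (z i) * w (z i)) =
      Matrix.det (Matrix.of fun i j => ∫ z, p i z * q j z * w z) := by
    rw [integral_finsetSum _ fun τ _ => hint σ τ]
    have h1 (τ : Equiv.Perm (Fin n)) :
        ∫ z : Fin n → ℂ, ((Equiv.Perm.sign σ : ℤ) * (Equiv.Perm.sign τ : ℤ) : ℂ) *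
          ∏ i, (p (σ i) (z i) * q (τ i) (z i) * w (z i)) =
        ((Equiv.Perm.sign σ : ℤ) * (Equiv.Perm.sign τ : ℤ) : ℂ) *
          ∏ i, ∫ z, p (σ i) z * q (τ i) z * w z := by
      rw [integral_const_mul]
      congr 1
      exact integral_fintype_prod_volume_eq_prod
        (fun i z => p (σ i) z * q (τ i) z * w z)
    simp_rw [h1]
    have h2 := Matrix.det_permute σ (Matrix.of fun i j => ∫ z, p i z * q j z * w z)
    have h3 : Matrix.det (Matrix.of fun i j => ∫ z, p i z * q j z * w z) =
        ((Equiv.Perm.sign σ : ℤ) : ℂ) * Matrix.det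
          ((Matrix.of fun i j => ∫ z, p i z * q j z * w z).submatrix σ id) := by
      rw [h2, ← mul_assoc, ← Int.cast_mul, ← Units.val_mul, Int.units_mul_self]
      simp
    rw [h3, ← Matrix.det_transpose, Matrix.det_apply', Finset.mul_sum]
    refine Finset.sum_congr rfl fun τ _ => ?_
    simp only [Matrix.transpose_apply, Matrix.submatrix_apply, Matrix.of_apply, id]
    ring
  simp_rw [key]
  simp [Fintype.card_perm]

end Andreief


/-! ### The weight filtration and the exponential -/

/-- The weight of a monomial in the couplings, where `t_m` and `t'_m` have weight `m`. -/
noncomputable def wt : ((ℕ+ ⊕ ℕ+) →₀ ℕ) →+ ℕ :=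
  Finsupp.weight (Sum.elim (fun m : ℕ+ => (m : ℕ)) (fun m : ℕ+ => (m : ℕ)))

/-- The ideal of the series all of whose monomials have weight at least `N`. -/
noncomputable def wtIdeal (N : ℕ) : Ideal Couplings where
  carrier := {f | ∀ d, wt d < N → MvPowerSeries.coeff d f = 0}
  zero_mem' := fun d _ => by simp
  add_mem' := fun {f g} hf hg d hd => by rw [map_add, hf d hd, hg d hd, add_zero]
  smul_mem' := fun c f hf d hd => by
    rw [smul_eq_mul, MvPowerSeries.coeff_mul]
    refine Finset.sum_eq_zero fun p hp => ?_
    have h : wt p.1 + wt p.2 = wt d := by rw [← map_add, Finset.HasAntidiagonal.mem_antidiagonal.1 hp]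
    rw [hf p.2 (by omega), mul_zero]

theorem mem_wtIdeal {N : ℕ} {f : Couplings} :
    f ∈ wtIdeal N ↔ ∀ d, wt d < N → MvPowerSeries.coeff d f = 0 := Iff.rfl

theorem mul_mem_wtIdeal_add {M N : ℕ} {f g : Couplings} (hf : f ∈ wtIdeal M)
    (hg : g ∈ wtIdeal N) : f * g ∈ wtIdeal (M + N) := by
  intro d hd
  rw [MvPowerSeries.coeff_mul]
  refine Finset.sum_eq_zero fun p hp => ?_
  have h : wt p.1 + wt p.2 = wt d := by rw [← map_add, Finset.HasAntidiagonal.mem_antidiagonal.1 hp]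
  rcases lt_or_ge (wt p.1) M with h1 | h1
  · rw [hf p.1 h1, zero_mul]
  · rw [hg p.2 (by omega), mul_zero]

theorem pow_mem_wtIdeal {f : Couplings} (hf : f ∈ wtIdeal 1) (j : ℕ) : f ^ j ∈ wtIdeal j := by
  induction j with
  | zero => intro d hd; omega
  | succ j ih => rw [pow_succ]; exact mul_mem_wtIdeal_add ih hf

/-- Identities of series are checked in these quotients, where the infinite sums become finite. -/
theorem coeff_eq_of_mk_eq {N : ℕ} {f g : Couplings}
    (h : Ideal.Quotient.mk (wtIdeal N) f = Ideal.Quotient.mk (wtIdeal N) g)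
    {d : (ℕ+ ⊕ ℕ+) →₀ ℕ} (hd : wt d < N) :
    MvPowerSeries.coeff d f = MvPowerSeries.coeff d g := by
  have := Ideal.Quotient.eq.1 h d hd
  rwa [map_sub, sub_eq_zero] at this

theorem hasSubst_of_mem_wtIdeal {f : Couplings} (hf : f ∈ wtIdeal 1) :
    PowerSeries.HasSubst f := by
  refine PowerSeries.HasSubst.of_constantCoeff_zero ?_
  rw [← MvPowerSeries.coeff_zero_eq_constantCoeff_apply]
  exact hf 0 (by simp)

/-- `f ^ j` has weight at least `j`, so `f` is nilpotent in the quotient and the exponential series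
stops before `j = N`. -/
theorem mk_exp_subst {f : Couplings} (hf : f ∈ wtIdeal 1) (N : ℕ) :
    Ideal.Quotient.mk (wtIdeal N) ((PowerSeries.exp ℂ).subst f) =
      IsNilpotent.exp (Ideal.Quotient.mk (wtIdeal N) f) := by
  have hN : (Ideal.Quotient.mk (wtIdeal N) f) ^ N = 0 := by
    rw [← map_pow]
    exact Ideal.Quotient.eq_zero_iff_mem.2 (pow_mem_wtIdeal hf N)
  rw [IsNilpotent.exp_eq_sum hN]
  simp_rw [← map_pow, ← map_rat_smul (Ideal.Quotient.mk (wtIdeal N)), ← map_sum]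
  refine Ideal.Quotient.eq.2 fun d hd => ?_
  rw [map_sub, sub_eq_zero, PowerSeries.coeff_subst (hasSubst_of_mem_wtIdeal hf),
    finsum_eq_sum_of_support_subset (s := Finset.range N), map_sum]
  · refine Finset.sum_congr rfl fun j _ => ?_
    rw [map_rat_smul (MvPowerSeries.coeff (R := ℂ) d), PowerSeries.coeff_exp, smul_eq_mul,
      Rat.smul_def]
    simp
  · intro j hj
    rw [Function.mem_support] at hj
    by_contra hjN
    simp only [Finset.coe_range, Set.mem_Iio, not_lt] at hjN
    exact hj (by rw [pow_mem_wtIdeal hf j d (by omega), smul_zero])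

theorem exp_subst_add {f g : Couplings} (hf : f ∈ wtIdeal 1) (hg : g ∈ wtIdeal 1) :
    (PowerSeries.exp ℂ).subst (f + g) =
      (PowerSeries.exp ℂ).subst f * (PowerSeries.exp ℂ).subst g := by
  ext d
  refine coeff_eq_of_mk_eq (N := wt d + 1) ?_ (Nat.lt_succ_self _)
  have nil {f : Couplings} (hf : f ∈ wtIdeal 1) :
      IsNilpotent (Ideal.Quotient.mk (wtIdeal (wt d + 1)) f) :=
    ⟨wt d + 1, by
      rw [← map_pow]
      exact Ideal.Quotient.eq_zero_iff_mem.2 (pow_mem_wtIdeal hf _)⟩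
  rw [map_mul, mk_exp_subst hf, mk_exp_subst hg, mk_exp_subst (Ideal.add_mem _ hf hg), map_add,
    IsNilpotent.exp_add_of_commute (Commute.all _ _) (nil hf) (nil hg)]

/-! ### Homogeneity and elementary Schur functions -/

/-- `G` is homogeneous, in the sense that its coefficient of `x ^ k` has weight `k`, and `F` is its
value at `x = z`. -/
def IsHomogeneousValue (z : ℂ) (F : Couplings) (G : PowerSeries Couplings) : Prop :=
  (∀ d, MvPowerSeries.coeff d F =
    z ^ wt d * MvPowerSeries.coeff d (PowerSeries.coeff (wt d) G)) ∧
  ∀ d k, k ≠ wt d → MvPowerSeries.coeff d (PowerSeries.coeff k G) = 0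

theorem IsHomogeneousValue.one (z : ℂ) : IsHomogeneousValue z 1 1 := by
  classical
  refine ⟨fun d => ?_, fun d k hk => ?_⟩
  · rw [PowerSeries.coeff_one, MvPowerSeries.coeff_one]
    by_cases hd : d = 0
    · subst hd; simp
    · by_cases hw : wt d = 0
      · simp [hw, hd, MvPowerSeries.coeff_one]
      · simp [hw, hd]
  · rw [PowerSeries.coeff_one]
    split_ifs with h
    · rw [MvPowerSeries.coeff_one, if_neg]
      rintro rfl
      exact hk (by simp [h])
    · simp

theorem IsHomogeneousValue.mul {z : ℂ} {F F' : Couplings} {G G' : PowerSeries Couplings}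
    (h : IsHomogeneousValue z F G) (h' : IsHomogeneousValue z F' G') :
    IsHomogeneousValue z (F * F') (G * G') := by
  classical
  refine ⟨fun d => ?_, fun d k hk => ?_⟩
  · rw [MvPowerSeries.coeff_mul, PowerSeries.coeff_mul, map_sum]
    simp_rw [MvPowerSeries.coeff_mul]
    rw [Finset.sum_comm, Finset.mul_sum]
    refine Finset.sum_congr rfl fun p hp => ?_
    have hw : wt p.1 + wt p.2 = wt d := by rw [← map_add, Finset.HasAntidiagonal.mem_antidiagonal.1 hp]
    rw [Finset.sum_eq_single (wt p.1, wt p.2), h.1, h'.1, ← hw, pow_add]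
    · ring
    · rintro ⟨a, b⟩ _ hne
      by_cases ha : a = wt p.1
      · rw [h'.2 p.2 b (fun hb => hne (by rw [ha, hb])), mul_zero]
      · rw [h.2 p.1 a ha, zero_mul]
    · intro hn
      exact absurd (Finset.HasAntidiagonal.mem_antidiagonal.2 hw) hn
  · rw [PowerSeries.coeff_mul, map_sum]
    refine Finset.sum_eq_zero fun q hq => ?_
    rw [MvPowerSeries.coeff_mul]
    refine Finset.sum_eq_zero fun p hp => ?_
    have hw : wt p.1 + wt p.2 = wt d := by rw [← map_add, Finset.HasAntidiagonal.mem_antidiagonal.1 hp]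
    have hk' := Finset.HasAntidiagonal.mem_antidiagonal.1 hq
    by_cases ha : q.1 = wt p.1
    · rw [h'.2 p.2 q.2 (by omega), mul_zero]
    · rw [h.2 p.1 q.1 ha, zero_mul]

theorem IsHomogeneousValue.pow {z : ℂ} {F : Couplings} {G : PowerSeries Couplings}
    (h : IsHomogeneousValue z F G) (j : ℕ) : IsHomogeneousValue z (F ^ j) (G ^ j) := by
  induction j with
  | zero => simpa using IsHomogeneousValue.one z
  | succ j ih => rw [pow_succ, pow_succ]; exact ih.mul h

/-- A family of couplings `u m`, each of which is a variable of weight `m`. -/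
def IsCouplingFamily (u : ℕ+ → Couplings) : Prop :=
  ∃ ι : ℕ+ → ℕ+ ⊕ ℕ+, (∀ m, u m = MvPowerSeries.X (ι m)) ∧
    ∀ m, wt (Finsupp.single (ι m) 1) = m

theorem isCouplingFamily_t : IsCouplingFamily t :=
  ⟨Sum.inl, fun _ => rfl, fun m => by simp [wt, Finsupp.weight_single]⟩

theorem isCouplingFamily_t' : IsCouplingFamily t' :=
  ⟨Sum.inr, fun _ => rfl, fun m => by simp [wt, Finsupp.weight_single]⟩

/-- The generating series `∑_{m ≥ 1} x^m u_m`. -/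
noncomputable def genSeries (u : ℕ+ → Couplings) : PowerSeries Couplings :=
  PowerSeries.mk fun m : ℕ => if hm : 0 < m then u ⟨m, hm⟩ else 0

theorem hasSubst_genSeries (u : ℕ+ → Couplings) : PowerSeries.HasSubst (genSeries u) :=
  PowerSeries.HasSubst.of_constantCoeff_zero' (by
    rw [← PowerSeries.coeff_zero_eq_constantCoeff_apply]
    simp [genSeries])

namespace IsCouplingFamily

variable {u : ℕ+ → Couplings}

theorem coeff_eq_zero (hu : IsCouplingFamily u) {m : ℕ+} {d : (ℕ+ ⊕ ℕ+) →₀ ℕ}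
    (h : (m : ℕ) ≠ wt d) : MvPowerSeries.coeff d (u m) = 0 := by
  classical
  obtain ⟨ι, hι, hw⟩ := hu
  rw [hι, MvPowerSeries.coeff_X, if_neg]
  rintro rfl
  exact h (hw m).symm

theorem isHomogeneousValue (hu : IsCouplingFamily u) (z : ℂ) :
    IsHomogeneousValue z (xi u z) (genSeries u) := by
  refine ⟨fun d => ?_, fun d k hk => ?_⟩
  · change (∑ᶠ m : ℕ+, MvPowerSeries.coeff d (MvPowerSeries.C (z ^ (m : ℕ)) * u m)) = _
    simp_rw [MvPowerSeries.coeff_C_mul]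
    by_cases h0 : 0 < wt d
    · rw [finsum_eq_single _ (show ℕ+ from ⟨wt d, h0⟩)]
      · simp [genSeries, h0]
      · intro m hm
        rw [hu.coeff_eq_zero, mul_zero]
        exact fun h => hm (PNat.eq h)
    · rw [finsum_eq_zero_of_forall_eq_zero]
      · simp [genSeries, h0]
      · intro m
        rw [hu.coeff_eq_zero, mul_zero]
        have := m.pos
        omega
  · rw [genSeries, PowerSeries.coeff_mk]
    split_ifs with h
    · exact hu.coeff_eq_zero hk
    · simp

theorem xi_mem (hu : IsCouplingFamily u) (z : ℂ) : xi u z ∈ wtIdeal 1 := by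
  intro d hd
  have h0 : wt d = 0 := by omega
  rw [(hu.isHomogeneousValue z).1, h0]
  simp [genSeries]

theorem coeff_elemSchur (u : ℕ+ → Couplings) (d : (ℕ+ ⊕ ℕ+) →₀ ℕ) (k : ℕ) :
    MvPowerSeries.coeff d (elemSchur u k) = ∑ᶠ j : ℕ, (j ! : ℂ)⁻¹ *
      MvPowerSeries.coeff d (PowerSeries.coeff k (genSeries u ^ j)) := by
  have hfin := PowerSeries.coeff_subst_finite' (hasSubst_genSeries u)
    (PowerSeries.exp Couplings) k
  have hterm (j : ℕ) : MvPowerSeries.coeff d (PowerSeries.coeff j (PowerSeries.exp Couplings) •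
      PowerSeries.coeff k (genSeries u ^ j)) = (j ! : ℂ)⁻¹ *
      MvPowerSeries.coeff d (PowerSeries.coeff k (genSeries u ^ j)) := by
    rw [PowerSeries.coeff_exp, algebraMap_smul, map_rat_smul (MvPowerSeries.coeff (R := ℂ) d),
      Rat.smul_def]
    simp
  rw [elemSchur, if_neg (by omega), Int.toNat_natCast]
  change MvPowerSeries.coeff d (PowerSeries.coeff k
    ((PowerSeries.exp Couplings).subst (genSeries u))) = _
  rw [PowerSeries.coeff_subst' (hasSubst_genSeries u)]
  have := (MvPowerSeries.coeff (R := ℂ) d).toAddMonoidHom.map_finsum hfin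
  simp only [LinearMap.toAddMonoidHom_coe] at this
  rw [this]
  exact finsum_congr hterm

theorem coeff_elemSchur_eq_zero (hu : IsCouplingFamily u) {d : (ℕ+ ⊕ ℕ+) →₀ ℕ} {k : ℤ}
    (hk : k ≠ wt d) : MvPowerSeries.coeff d (elemSchur u k) = 0 := by
  rcases lt_or_ge k 0 with h | h
  · rw [elemSchur, if_pos h, map_zero]
  · lift k to ℕ using h
    rw [coeff_elemSchur u d k]
    refine finsum_eq_zero_of_forall_eq_zero fun j => ?_
    -- Homogeneity does not depend on the point; `0` is an arbitrary choice.
    rw [((hu.isHomogeneousValue 0).pow j).2 d k (by exact_mod_cast hk), mul_zero]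

theorem elemSchur_mem (hu : IsCouplingFamily u) {N : ℕ} {k : ℤ} (hk : N ≤ k) :
    elemSchur u k ∈ wtIdeal N :=
  fun d hd => hu.coeff_elemSchur_eq_zero (by omega)

/-- By homogeneity, a monomial of weight `k` occurs in each power of the generating series only with
`x^k`. Setting `x = z` thus multiplies its coefficient by `z^k`. -/
theorem coeff_exp_subst_xi (hu : IsCouplingFamily u) (z : ℂ) (d : (ℕ+ ⊕ ℕ+) →₀ ℕ) :
    MvPowerSeries.coeff d ((PowerSeries.exp ℂ).subst (xi u z)) =
      z ^ wt d * MvPowerSeries.coeff d (elemSchur u (wt d)) := by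
  rw [PowerSeries.coeff_subst (hasSubst_of_mem_wtIdeal (hu.xi_mem z)), coeff_elemSchur, mul_finsum]
  refine finsum_congr fun j => ?_
  rw [((hu.isHomogeneousValue z).pow j).1, PowerSeries.coeff_exp, smul_eq_mul]
  simp
  ring

/-- `z^b e^{ξ(u, z)} = ∑_a z^a h_{a-b}(u)`, up to terms of weight at least `N`. -/
theorem mk_C_mul_exp_subst_xi (hu : IsCouplingFamily u) (z : ℂ) (N b L : ℕ) (hL : N + b ≤ L) :
    Ideal.Quotient.mk (wtIdeal N)
      (MvPowerSeries.C (z ^ b) * (PowerSeries.exp ℂ).subst (xi u z)) =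
    Ideal.Quotient.mk (wtIdeal N)
      (∑ a ∈ Finset.range L, MvPowerSeries.C (z ^ a) * elemSchur u ((a : ℤ) - b)) := by
  refine Ideal.Quotient.eq.2 fun d hd => ?_
  rw [map_sub, sub_eq_zero, map_sum]
  simp_rw [MvPowerSeries.coeff_C_mul]
  -- `h_{a-b}` is homogeneous of weight `a - b`, so only `a = wt d + b` contributes; it lies below
  -- `N + b ≤ L`.
  rw [Finset.sum_eq_single (wt d + b), hu.coeff_exp_subst_xi, pow_add]
  · simp only [Nat.cast_add, add_sub_cancel_right]
    ring
  · intro a _ ha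
    rw [hu.coeff_elemSchur_eq_zero (by omega), mul_zero]
  · intro h
    exact absurd (Finset.mem_range.2 (by omega)) h

end IsCouplingFamily

theorem elemSchur_zero (u : ℕ+ → Couplings) : elemSchur u 0 = 1 := by
  rw [elemSchur, if_neg (lt_irrefl _), Int.toNat_zero]
  change PowerSeries.coeff 0 ((PowerSeries.exp Couplings).subst (genSeries u)) = 1
  rw [PowerSeries.coeff_subst' (hasSubst_genSeries u), finsum_eq_single _ 0]
  · simp
  · intro j hj
    have h0 : PowerSeries.constantCoeff (genSeries u) = 0 := by
      rw [← PowerSeries.coeff_zero_eq_constantCoeff_apply]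
      simp [genSeries]
    rw [PowerSeries.coeff_zero_eq_constantCoeff_apply (_ ^ _), map_pow, h0, zero_pow hj, smul_zero]

theorem elemSchur_of_neg (u : ℕ+ → Couplings) {k : ℤ} (hk : k < 0) : elemSchur u k = 0 :=
  if_pos hk


/-! ### Partitions and decreasing sequences -/

namespace Ptn

theorem apply_eq_zero (l : Ptn) {i : ℕ} (hi : l.length ≤ i) : l.1 i = 0 := by
  by_contra h
  have hsub : Finset.range (i + 1) ⊆ l.1.support := fun j hj => by
    have := l.2 (Nat.le_of_lt_succ (Finset.mem_range.1 hj))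
    rw [Finsupp.mem_support_iff]
    omega
  have := Finset.card_le_card hsub
  rw [Finset.card_range] at this
  exact absurd (this.trans hi) (by omega)

theorem shifted_strictAnti {n : ℕ} (l : Ptn) : StrictAnti (l.shifted (n := n)) := by
  intro i j hij
  have h1 : (i : ℕ) < j := hij
  have h2 := l.2 h1.le
  have h3 := j.2
  simp only [shifted]
  omega

end Ptn

/-- There are `n - (i + 1)` further terms after `f i`, and each step down loses at least one. This
keeps `f i - (n - (i + 1))` from being truncated when the partition is recovered. -/
theorem sub_le_apply_of_strictAnti {n : ℕ} {f : Fin n → ℕ} (hf : StrictAnti f) (i : Fin n) :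
    n - (i + 1) ≤ f i := by
  obtain ⟨k, hk⟩ : ∃ k : ℕ, k = n - (i + 1) := ⟨_, rfl⟩
  rw [← hk]
  induction k generalizing i with
  | zero => exact Nat.zero_le _
  | succ k ih =>
    have h1 : (i : ℕ) + 1 < n := by omega
    have h2 := ih ⟨i + 1, h1⟩ (by simp only; omega)
    have h3 : f ⟨i + 1, h1⟩ < f i := hf (Fin.lt_def.2 (Nat.lt_succ_self _))
    omega

/-- A partition of length at most `n` is determined by its shifted parts, which form an arbitrary
decreasing sequence. -/
theorem bijective_shifted (n : ℕ) : Function.Bijective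
    fun l : {l : Ptn // l.length ≤ n} =>
      (⟨l.1.shifted, l.1.shifted_strictAnti⟩ : {f : Fin n → ℕ // StrictAnti f}) := by
  constructor
  · rintro ⟨l, hl⟩ ⟨m, hm⟩ h
    have h' := congrArg Subtype.val h
    refine Subtype.ext (Subtype.ext (Finsupp.ext fun i => ?_))
    by_cases hi : i < n
    · have := congrFun h' ⟨i, hi⟩
      simp only [Ptn.shifted] at this
      change l.1 i = m.1 i
      omega
    · simp only
      rw [l.apply_eq_zero (by omega), m.apply_eq_zero (by omega)]
  · rintro ⟨f, hf⟩
    let g : ℕ → ℕ := fun i => if h : i < n then f ⟨i, h⟩ - (n - (i + 1)) else 0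
    have hg (i : ℕ) (hi : g i ≠ 0) : i ∈ Finset.range n := by
      by_contra h
      exact hi (dif_neg (by simpa using h))
    let l : ℕ →₀ ℕ := Finsupp.onFinset (Finset.range n) g hg
    have hl : Antitone l := antitone_nat_of_succ_le fun i => by
      change g (i + 1) ≤ g i
      by_cases h : i + 1 < n
      · have h3 : f ⟨i + 1, h⟩ < f ⟨i, by omega⟩ := hf (Fin.lt_def.2 (Nat.lt_succ_self _))
        simp only [g, dif_pos h, dif_pos (show i < n by omega)]
        omega
      · simp [g, dif_neg h]
    have hlen : Ptn.length ⟨l, hl⟩ ≤ n := by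
      refine (Finset.card_le_card (Finsupp.support_onFinset_subset (hf := hg))).trans ?_
      rw [Finset.card_range]
    refine ⟨⟨⟨l, hl⟩, hlen⟩, Subtype.ext (funext fun i => ?_)⟩
    change g i + n - (i + 1) = f i
    have := sub_le_apply_of_strictAnti hf i
    have := i.2
    simp only [g, dif_pos i.2, Fin.eta]
    omega

/-! ### Schur functions as minors -/

/-- The determinant `det (h_{a_i - n + j}(u))`, for `1 ≤ i, j ≤ n`. -/
noncomputable def minor (u : ℕ+ → Couplings) {n : ℕ} (a : Fin n → ℕ) : Couplings :=
  Matrix.det (Matrix.of fun i j : Fin n => elemSchur u ((a i : ℤ) - (n - (j + 1) : ℕ)))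

/-- A row with zero part has entries `h_{j-i}`, which vanish left of the diagonal and equal `1` on
it. Expansion along the last row therefore removes it. -/
theorem schur_eq_det (u : ℕ+ → Couplings) (l : Ptn) {n : ℕ} (hn : l.length ≤ n) :
    schur u l = Matrix.det (Matrix.of fun i j : Fin n =>
      elemSchur u ((l.1 i : ℤ) - (i : ℤ) + (j : ℤ))) := by
  induction n, hn using Nat.le_induction with
  | base => rfl
  | succ n hn ih =>
    rw [ih, Matrix.det_succ_row _ (Fin.last n), Fin.sum_univ_castSucc, Finset.sum_eq_zero, zero_add]
    · simp only [Matrix.of_apply, Fin.val_last, l.apply_eq_zero hn]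
      have h0 : ((0 : ℕ) : ℤ) - (n : ℤ) + (n : ℤ) = 0 := by simp
      rw [h0, elemSchur_zero, Even.neg_one_pow ⟨n, rfl⟩, one_mul, one_mul]
      congr 1
      ext1 i j
      simp
    · intro j _
      rw [Matrix.of_apply, elemSchur_of_neg, mul_zero, zero_mul]
      simp only [Fin.val_last, l.apply_eq_zero hn, Fin.val_castSucc]
      have := j.2
      omega

theorem schur_eq_minor (u : ℕ+ → Couplings) (l : Ptn) {n : ℕ} (hn : l.length ≤ n) :
    schur u l = minor u (l.shifted (n := n)) := by
  rw [schur_eq_det u l hn, minor]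
  congr 1
  ext1 i j
  simp only [Matrix.of_apply, Ptn.shifted]
  congr 1
  have := i.2
  have := j.2
  omega

/-- Every entry of row `i` is some `h_k` with `k ≥ N`, and each Leibniz term has a factor from that
row. Hence only finitely many minors reach a given monomial. -/
theorem IsCouplingFamily.minor_mem {u : ℕ+ → Couplings} (hu : IsCouplingFamily u) {N n : ℕ}
    {a : Fin n → ℕ} {i : Fin n} (hi : N + n ≤ a i) : minor u a ∈ wtIdeal N := by
  rw [minor, Matrix.det_apply]
  refine Ideal.sum_mem _ fun σ _ => ?_
  rw [Units.smul_def, zsmul_eq_mul]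
  refine Ideal.mul_mem_left _ _ ?_
  obtain ⟨j, rfl⟩ := σ.surjective i
  refine Ideal.mem_of_dvd _ (Finset.dvd_prod_of_mem _ (Finset.mem_univ j)) ?_
  refine hu.elemSchur_mem ?_
  omega


/-! ### Expansion and integration of the integrand -/

open Classical in
/-- The decreasing sequences of length `n` with values below `L`. -/
noncomputable def decreasingSeqs (n L : ℕ) : Finset (Fin n → ℕ) :=
  {f ∈ Fintype.piFinset fun _ : Fin n => Finset.range L | StrictAnti f}

theorem IsCouplingFamily.mk_vandermondeDet_mul_prod {u : ℕ+ → Couplings}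
    (hu : IsCouplingFamily u) {n : ℕ} (N : ℕ) (z : Fin n → ℂ) :
    Ideal.Quotient.mk (wtIdeal N) (MvPowerSeries.C (vandermondeDet z) *
      ∏ i, (PowerSeries.exp ℂ).subst (xi u (z i))) =
    Ideal.Quotient.mk (wtIdeal N) (∑ f ∈ decreasingSeqs n (N + n),
      MvPowerSeries.C (Matrix.det (Matrix.of fun i j => z i ^ f j)) * minor u f) := by
  classical
  -- The factor `e^{ξ(u, z_i)}` is absorbed into row `i` of the Vandermonde matrix.
  have h1 : MvPowerSeries.C (vandermondeDet z) *
      ∏ i, (PowerSeries.exp ℂ).subst (xi u (z i)) =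
      Matrix.det (Matrix.of fun i j : Fin n => MvPowerSeries.C (z i ^ (n - ((j : ℕ) + 1))) *
        (PowerSeries.exp ℂ).subst (xi u (z i))) := by
    rw [vandermondeDet, RingHom.map_det, mul_comm, ← Matrix.det_mul_column]
    congr 1
    ext1 i j
    simp [mul_comm]
  have h2 := det_sum_mul_eq_sum_strictAnti (n := n) (Finset.range (N + n))
    (fun i a => (MvPowerSeries.C (z i ^ a) : Couplings))
    (fun a j => elemSchur u ((a : ℤ) - (n - (j + 1) : ℕ)))
  have h3 : ∑ f ∈ decreasingSeqs n (N + n),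
      MvPowerSeries.C (Matrix.det (Matrix.of fun i j => z i ^ f j)) * minor u f =
      Matrix.det (Matrix.of fun i j : Fin n => ∑ a ∈ Finset.range (N + n),
        MvPowerSeries.C (z i ^ a) * elemSchur u ((a : ℤ) - (n - (j + 1) : ℕ))) := by
    rw [h2, decreasingSeqs]
    refine Finset.sum_congr (by congr) fun f _ => ?_
    rw [RingHom.map_det]
    rfl
  rw [h1, h3, RingHom.map_det, RingHom.map_det]
  congr 1
  ext1 i j
  exact hu.mk_C_mul_exp_subst_xi (z i) N _ _ (by omega)

/-- Both `|Δ(z)|² = Δ(z) Δ(z̄)` and the exponential of `ξ(t, z) + ξ(t', z̄)` split into a part in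
`z, t` and a part in `z̄, t'`, each expanded by Cauchy–Binet. -/
theorem coeff_integrand (V : ℂ → ℂ → WithBot ℂ) {n : ℕ} (z : Fin n → ℂ)
    (d : (ℕ+ ⊕ ℕ+) →₀ ℕ) {N : ℕ} (hd : wt d < N) :
    MvPowerSeries.coeff d (integrand V z) =
      ∑ f ∈ decreasingSeqs n (N + n), ∑ g ∈ decreasingSeqs n (N + n),
        (Matrix.det (Matrix.of fun i j => z i ^ f j) *
          Matrix.det (Matrix.of fun i j => conj (z i) ^ g j) * ∏ i, weight V (z i)) *
        MvPowerSeries.coeff d (minor t f * minor t' g) := by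
  have hconj : vandermondeDet (fun i => conj (z i)) = conj (vandermondeDet z) := by
    rw [vandermondeDet, vandermondeDet, RingHom.map_det]
    congr 1
    ext1 i j
    simp
  have h1 : integrand V z = MvPowerSeries.C (∏ i, weight V (z i)) *
      (MvPowerSeries.C (vandermondeDet z) * ∏ i, (PowerSeries.exp ℂ).subst (xi t (z i))) *
      (MvPowerSeries.C (vandermondeDet fun i => conj (z i)) *
        ∏ i, (PowerSeries.exp ℂ).subst (xi t' (conj (z i)))) := by
    rw [integrand, hconj]
    simp_rw [exp_subst_add (isCouplingFamily_t.xi_mem _) (isCouplingFamily_t'.xi_mem _),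
      Finset.prod_mul_distrib]
    rw [Complex.ofReal_pow, ← Complex.mul_conj', map_mul, map_prod]
    ring
  have h2 : MvPowerSeries.coeff d (integrand V z) = MvPowerSeries.coeff d
      (MvPowerSeries.C (∏ i, weight V (z i)) *
      (∑ f ∈ decreasingSeqs n (N + n),
        MvPowerSeries.C (Matrix.det (Matrix.of fun i j => z i ^ f j)) * minor t f) *
      (∑ g ∈ decreasingSeqs n (N + n),
        MvPowerSeries.C (Matrix.det (Matrix.of fun i j => conj (z i) ^ g j)) * minor t' g)) := by
    refine coeff_eq_of_mk_eq ?_ hd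
    rw [h1, map_mul, map_mul, isCouplingFamily_t.mk_vandermondeDet_mul_prod,
      isCouplingFamily_t'.mk_vandermondeDet_mul_prod, ← map_mul, ← map_mul]
  rw [h2, mul_assoc, Finset.sum_mul_sum, Finset.mul_sum, map_sum]
  refine Finset.sum_congr rfl fun f _ => ?_
  rw [Finset.mul_sum, map_sum]
  refine Finset.sum_congr rfl fun g _ => ?_
  rw [← MvPowerSeries.coeff_C_mul]
  congr 1
  simp only [map_mul]
  ring

theorem integrable_det_mul_det_weight {V : ℂ → ℂ → WithBot ℂ}
    (hV : ∀ k m : ℕ, Integrable (fun z : ℂ => z ^ k * conj z ^ m * weight V z) volume)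
    {n : ℕ} (f g : Fin n → ℕ) :
    Integrable (fun z : Fin n → ℂ => Matrix.det (Matrix.of fun i j => z i ^ f j) *
      Matrix.det (Matrix.of fun i j => conj (z i) ^ g j) * ∏ i, weight V (z i)) volume :=
  integrable_det_mul_det_mul_prod (p := fun i z => z ^ f i) (q := fun i z => conj z ^ g i)
    (w := weight V) fun i j => hV (f i) (g j)

theorem coeff_partitionFunction {V : ℂ → ℂ → WithBot ℂ}
    (hV : ∀ k m : ℕ, Integrable (fun z : ℂ => z ^ k * conj z ^ m * weight V z) volume)
    (n : ℕ) (d : (ℕ+ ⊕ ℕ+) →₀ ℕ) {N : ℕ} (hd : wt d < N) :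
    MvPowerSeries.coeff d (partitionFunction V n) =
      (n ! : ℂ) * ∑ f ∈ decreasingSeqs n (N + n), ∑ g ∈ decreasingSeqs n (N + n),
        Matrix.det (Matrix.of fun i j => bimoment V (f i) (g j)) *
        MvPowerSeries.coeff d (minor t f * minor t' g) := by
  change ∫ z : Fin n → ℂ, MvPowerSeries.coeff d (integrand V z) = _
  simp_rw [coeff_integrand V _ d hd]
  rw [integral_finsetSum _ fun f _ => integrable_finsetSum _ fun g _ =>
    (integrable_det_mul_det_weight hV f g).mul_const _, Finset.mul_sum]
  refine Finset.sum_congr rfl fun f _ => ?_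
  rw [integral_finsetSum _ fun g _ => (integrable_det_mul_det_weight hV f g).mul_const _,
    Finset.mul_sum]
  refine Finset.sum_congr rfl fun g _ => ?_
  have := integral_det_mul_det_mul_prod (p := fun i z => z ^ f i) (q := fun i z => conj z ^ g i)
    (w := weight V) fun i j => hV (f i) (g j)
  rw [integral_mul_const, this, mul_assoc]
  rfl

/-- The coefficient of a monomial in `doubleSchurTerm`, in terms of shifted parts. -/
noncomputable def coeffTerm (V : ℂ → ℂ → WithBot ℂ) (n : ℕ) (d : (ℕ+ ⊕ ℕ+) →₀ ℕ)
    (p : {f : Fin n → ℕ // StrictAnti f} × {f : Fin n → ℕ // StrictAnti f}) : ℂ :=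
  Matrix.det (Matrix.of fun i j => bimoment V (p.1.1 i) (p.2.1 j)) *
    MvPowerSeries.coeff d (minor t p.1.1 * minor t' p.2.1)

theorem coeff_doubleSchurTerm (V : ℂ → ℂ → WithBot ℂ) (n : ℕ) (d : (ℕ+ ⊕ ℕ+) →₀ ℕ)
    (p : {l : Ptn // l.length ≤ n} × {l : Ptn // l.length ≤ n}) :
    MvPowerSeries.coeff d (doubleSchurTerm V n p) = coeffTerm V n d
      (Prod.map (fun l => ⟨l.1.shifted, l.1.shifted_strictAnti⟩)
        (fun l => ⟨l.1.shifted, l.1.shifted_strictAnti⟩) p) := by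
  rw [doubleSchurTerm, mul_assoc, MvPowerSeries.coeff_C_mul, schur_eq_minor t _ p.1.2,
    schur_eq_minor t' _ p.2.2]
  rfl

open Classical in
theorem support_coeffTerm_subset (V : ℂ → ℂ → WithBot ℂ) (n : ℕ) (d : (ℕ+ ⊕ ℕ+) →₀ ℕ)
    {N : ℕ} (hd : wt d < N) :
    Function.support (coeffTerm V n d) ⊆
      ((decreasingSeqs n (N + n)).subtype StrictAnti ×ˢ
        (decreasingSeqs n (N + n)).subtype StrictAnti : Finset _) := by
  rintro ⟨⟨f, hf⟩, ⟨g, hg⟩⟩ hp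
  rw [Function.mem_support, coeffTerm] at hp
  have hp := right_ne_zero_of_mul hp
  simp only [Finset.coe_product, Set.mem_prod, Finset.mem_coe, Finset.mem_subtype,
    decreasingSeqs, Finset.mem_filter, Fintype.mem_piFinset, Finset.mem_range, hf, hg, and_true]
  constructor
  · intro i
    by_contra hi
    exact hp (Ideal.mul_mem_right _ _ (isCouplingFamily_t.minor_mem (not_lt.1 hi)) d hd)
  · intro i
    by_contra hi
    exact hp (Ideal.mul_mem_left _ _ (isCouplingFamily_t'.minor_mem (not_lt.1 hi)) d hd)

theorem formallySummable_doubleSchurTerm (V : ℂ → ℂ → WithBot ℂ) (n : ℕ) :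
    FormallySummable (doubleSchurTerm V n) := by
  classical
  intro d
  simp_rw [coeff_doubleSchurTerm]
  have hfin := (Finset.finite_toSet _).subset
    (support_coeffTerm_subset V n d (Nat.lt_succ_self (wt d)))
  exact hfin.preimage
    ((bijective_shifted n).injective.prodMap (bijective_shifted n).injective).injOn

theorem coeff_formalSum_doubleSchurTerm (V : ℂ → ℂ → WithBot ℂ) (n : ℕ)
    (d : (ℕ+ ⊕ ℕ+) →₀ ℕ) {N : ℕ} (hd : wt d < N) :
    MvPowerSeries.coeff d (formalSum (doubleSchurTerm V n)) =
      ∑ f ∈ decreasingSeqs n (N + n), ∑ g ∈ decreasingSeqs n (N + n),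
        Matrix.det (Matrix.of fun i j => bimoment V (f i) (g j)) *
        MvPowerSeries.coeff d (minor t f * minor t' g) := by
  classical
  change ∑ᶠ p, MvPowerSeries.coeff d (doubleSchurTerm V n p) = _
  rw [finsum_eq_of_bijective _ ((bijective_shifted n).prodMap (bijective_shifted n))
    (coeff_doubleSchurTerm V n d),
    finsum_eq_sum_of_support_subset _ (support_coeffTerm_subset V n d hd), Finset.sum_product]
  have hmem : ∀ f ∈ decreasingSeqs n (N + n), StrictAnti f :=
    fun f hf => (Finset.mem_filter.1 hf).2
  rw [← Finset.sum_subtype_of_mem _ hmem]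
  refine Finset.sum_congr rfl fun f _ => ?_
  rw [← Finset.sum_subtype_of_mem _ hmem]
  rfl

end NormalMatrixModel

theorem theorem1 (n : ℕ) (V : ℂ → ℂ → WithBot ℂ)
    (hV : ∀ k m : ℕ, Integrable
      (fun z : ℂ => z ^ k * conj z ^ m * NormalMatrixModel.weight V z) volume) :
    (∀ d : (ℕ+ ⊕ ℕ+) →₀ ℕ, Integrable
      (fun z : Fin n → ℂ => MvPowerSeries.coeff d (NormalMatrixModel.integrand V z)) volume) ∧
    NormalMatrixModel.FormallySummable (NormalMatrixModel.doubleSchurTerm V n) ∧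
    NormalMatrixModel.partitionFunction V n =
      (n ! : NormalMatrixModel.Couplings) *
        NormalMatrixModel.formalSum (NormalMatrixModel.doubleSchurTerm V n) := by
  refine ⟨fun d => ?_, NormalMatrixModel.formallySummable_doubleSchurTerm V n, ?_⟩
  · simp_rw [NormalMatrixModel.coeff_integrand V _ d (Nat.lt_succ_self _)]
    exact integrable_finsetSum _ fun f _ => integrable_finsetSum _ fun g _ =>
      (NormalMatrixModel.integrable_det_mul_det_weight hV f g).mul_const _
  · ext d
    rw [NormalMatrixModel.coeff_partitionFunction hV n d (Nat.lt_succ_self _),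
      ← map_natCast (MvPowerSeries.C (σ := ℕ+ ⊕ ℕ+) (R := ℂ)), MvPowerSeries.coeff_C_mul,
      NormalMatrixModel.coeff_formalSum_doubleSchurTerm V n d (Nat.lt_succ_self _)]
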